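/- For $L_1,L_2>0$ let $\Omega=(-L_1,L_1)\times(-L_2,L_2)\times(0,1)$ with coordinates $(x,y,z)$, and let $\mathcal A$ be the set of all $\mathbf n\in W^{1,2}(\Omega,\mathbb R^3)$ with $|\mathbf n|=1$ almost everywhere whose traces satisfy $$\mathbf n|_{z=0}=\mathbf e_1,\quad \mathbf n|_{z=1}=\mathbf e_3,\quad \mathbf n|_{x=-L_1}=\mathbf n|_{x=L_1},\quad \mathbf n|_{y=-L_2}=\mathbf n|_{y=L_2}.$$ For $t\ge 0$ and $\mathbf n\in\mathcal A$ let $$I(\mathbf n)=\int_\Omega |\nabla\mathbf n|^2+2t\,\mathbf n\cdot\nabla\times\mathbf n+t^2\,dx .$$ There is a constant $t^*>0$, independent of $L_1,L_2$, which can be taken with $t^*\ge 0.766$, such that the following holds whenever $0\le t\le t^*$. There is exactly one $D>t^2$ with $$\int_0^{\pi/2}\frac{du}{\sqrt{D-t^2\cos^2u}}=1,$$ there is exactly one function $\theta:[0,1]\to\mathbb R$ with $$\int_0^{\theta(z)}\frac{du}{\sqrt{D-t^2\cos^2u}}=z\qquad\text{for all } z\in[0,1],$$ and for all $L_1,L_2>0$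 the field $$\mathbf n^*(x,y,z)=\bigl(\cos\theta(z)\cos(tz),\ \cos\theta(z)\sin(tz),\ \sin\theta(z)\bigr)$$ belongs to $\mathcal A$ and is the unique global minimiser of $I$ over $\mathcal A$: $I(\mathbf n^*)\le I(\mathbf n)$ for every $\mathbf n\in\mathcal A$, with equality only if $\mathbf n=\mathbf n^*$ almost everywhere in $\Omega$. -/

import Mathlib

open MeasureTheory Filter
open scoped Topology ContDiff

noncomputable section

namespace Cholesteric

/-- Points of the domain, in coordinates `(x, y, z) = (p 0, p 1, p 2)`. Only the Lebesgue measure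
and the smooth structure of `ℝ³` are used on this side. -/
abbrev Pt : Type := Fin 3 → ℝ

/-- Values of the director field, with the Euclidean norm. -/
abbrev Vec : Type := EuclideanSpace ℝ (Fin 3)

/-- Lower corner of the cuboid `(-L₁, L₁) × (-L₂, L₂) × (0, 1)`. -/
def lo (L₁ L₂ : ℝ) : Pt := ![-L₁, -L₂, 0]

/-- Upper corner of the cuboid `(-L₁, L₁) × (-L₂, L₂) × (0, 1)`. -/
def hi (L₁ L₂ : ℝ) : Pt := ![L₁, L₂, 1]

/-- The open cuboid with corners `a` and `b`. -/
def box (a b : Pt) : Set Pt := Set.univ.pi fun i => Set.Ioo (a i) (b i)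

/-- The cuboid `Ω = (-L₁, L₁) × (-L₂, L₂) × (0, 1)`. -/
def cuboid (L₁ L₂ : ℝ) : Set Pt := box (lo L₁ L₂) (hi L₁ L₂)

/-! ### Weak derivatives and the Sobolev space `W^{1,2}` -/

section Sobolev

variable {F : Type*} [NormedAddCommGroup F] [NormedSpace ℝ F]

/-- The classical partial derivative `∂ⱼ φ`. -/
def pderiv (j : Fin 3) (φ : Pt → F) (p : Pt) : F := fderiv ℝ φ p (Pi.single j 1)

/-- `g` is the weak partial derivative `∂ⱼ u` on the open set `U`. -/
def IsWeakPartial (U : Set Pt) (j : Fin 3) (u g : Pt → F) : Prop :=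
  LocallyIntegrableOn u U ∧ LocallyIntegrableOn g U ∧
    ∀ φ : Pt → ℝ, ContDiff ℝ ∞ φ → HasCompactSupport φ → tsupport φ ⊆ U →
      ∫ p in U, pderiv j φ p • u p = -∫ p in U, φ p • g p

open Classical in
/-- The weak partial derivative `∂ⱼ u` on `U` (unique up to a null set when it exists; `0` by
convention when it does not). -/
def weakPartial (U : Set Pt) (j : Fin 3) (u : Pt → F) : Pt → F :=
  if h : ∃ g, IsWeakPartial U j u g then h.choose else 0

/-- Membership in `W^{1,2}(U; F)`: `u ∈ L²(U)` has weak partial derivatives, all in `L²(U)`. -/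
def MemW12 (U : Set Pt) (u : Pt → F) : Prop :=
  MemLp u 2 (volume.restrict U) ∧
    ∀ j, (∃ g, IsWeakPartial U j u g) ∧ MemLp (weakPartial U j u) 2 (volume.restrict U)

/-! ### Traces on the faces of a cuboid

The face of the cuboid with corners `a`, `b` on which the `i`-th coordinate is `a i` (`s = false`)
or `b i` (`s = true`) is parametrised by its two remaining coordinates. -/

/-- The value of the fixed coordinate on the face `(i, s)`. -/
def faceCoord (a b : Pt) (i : Fin 3) (s : Bool) : ℝ := if s then b i else a i

/-- The two-dimensional Lebesgue measure on a face orthogonal to the `i`-th axis. -/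
def faceMeasure (a b : Pt) (i : Fin 3) : Measure (Fin 2 → ℝ) :=
  volume.restrict (Set.Icc (a ∘ i.succAbove) (b ∘ i.succAbove))

/-- `T` is the boundary trace in `L²(∂Ω)` of `u ∈ W^{1,2}(Ω)`, for `Ω = box a b`: `T i s` is its
restriction to the face `(i, s)`. As usual, the trace operator is the continuous extension of the
restriction map: there are functions `w k`, smooth up to the boundary, which converge to `u` in
`W^{1,2}(Ω)` and whose restrictions to the faces converge to `T` in `L²`. -/
def IsTrace (a b : Pt) (u : Pt → F) (T : Fin 3 → Bool → (Fin 2 → ℝ) → F) : Prop :=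
  (∀ i s, MemLp (T i s) 2 (faceMeasure a b i)) ∧
    ∃ w : ℕ → Pt → F, (∀ k, ContDiff ℝ ∞ (w k)) ∧
      Tendsto (fun k => eLpNorm (w k - u) 2 (volume.restrict (box a b))) atTop (𝓝 0) ∧
      (∀ j, Tendsto (fun k => eLpNorm (pderiv j (w k) - weakPartial (box a b) j u) 2
        (volume.restrict (box a b))) atTop (𝓝 0)) ∧
      ∀ i s, Tendsto (fun k => eLpNorm
        (fun y => w k (i.insertNth (faceCoord a b i s) y) - T i s y) 2
        (faceMeasure a b i)) atTop (𝓝 0)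

end Sobolev

/-! ### The variational problem -/

/-- The admissible class: `n ∈ W^{1,2}(Ω, 𝕊²)` with `n = e₁` on `z = 0`, `n = e₃` on `z = 1`, and
equal traces on `x = ± L₁` and on `y = ± L₂`. -/
def Admissible (L₁ L₂ : ℝ) (n : Pt → Vec) : Prop :=
  MemW12 (cuboid L₁ L₂) n ∧
    (∀ᵐ p ∂volume.restrict (cuboid L₁ L₂), ‖n p‖ = 1) ∧
    ∃ T : Fin 3 → Bool → (Fin 2 → ℝ) → Vec, IsTrace (lo L₁ L₂) (hi L₁ L₂) n T ∧
      (T 2 false =ᵐ[faceMeasure (lo L₁ L₂) (hi L₁ L₂) 2] fun _ => !₂[1, 0, 0]) ∧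
      (T 2 true =ᵐ[faceMeasure (lo L₁ L₂) (hi L₁ L₂) 2] fun _ => !₂[0, 0, 1]) ∧
      (T 0 false =ᵐ[faceMeasure (lo L₁ L₂) (hi L₁ L₂) 0] T 0 true) ∧
      (T 1 false =ᵐ[faceMeasure (lo L₁ L₂) (hi L₁ L₂) 1] T 1 true)

/-- The curl of a field whose partial derivative `∂ⱼ` at the point considered is `d j`. -/
def curl (d : Fin 3 → Vec) : Vec :=
  !₂[d 1 2 - d 2 1, d 2 0 - d 0 2, d 0 1 - d 1 0]

/-- The one-constant energy `I(n) = ∫_Ω |∇n|² + 2t n · ∇ × n + t²`. -/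
def energy (L₁ L₂ t : ℝ) (n : Pt → Vec) : ℝ :=
  ∫ p in cuboid L₁ L₂,
    ((∑ j, ‖weakPartial (cuboid L₁ L₂) j n p‖ ^ 2)
      + 2 * t * inner ℝ (n p) (curl fun j => weakPartial (cuboid L₁ L₂) j n p) + t ^ 2)

/-- `m` is the unique global minimiser of the energy over the admissible class, where fields which
agree almost everywhere in `Ω` are identified. -/
def IsUniqueGlobalMinimiser (L₁ L₂ t : ℝ) (m : Pt → Vec) : Prop :=
  Admissible L₁ L₂ m ∧
    (∀ n, Admissible L₁ L₂ n → energy L₁ L₂ t m ≤ energy L₁ L₂ t n) ∧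
    ∀ n, Admissible L₁ L₂ n → energy L₁ L₂ t n = energy L₁ L₂ t m →
      n =ᵐ[volume.restrict (cuboid L₁ L₂)] m

/-! ### The one-variable director -/

/-- The constant `D` in the definition of `θ`: `∫_0^{π/2} (D - t² cos² u)^{-1/2} du = 1`. The
condition `t² < D` makes the integrand defined and continuous for every `u`. -/
def IsProfileConstant (t D : ℝ) : Prop :=
  t ^ 2 < D ∧ ∫ u in (0 : ℝ)..(Real.pi / 2), 1 / √(D - t ^ 2 * Real.cos u ^ 2) = 1

/-- The implicit equation `∫_0^{θ(z)} (D - t² cos² u)^{-1/2} du = z` for `θ` on `[0, 1]`. -/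
def IsProfile (t D : ℝ) (θ : ℝ → ℝ) : Prop :=
  ∀ z ∈ Set.Icc (0 : ℝ) 1,
    ∫ u in (0 : ℝ)..(θ z), 1 / √(D - t ^ 2 * Real.cos u ^ 2) = z

/-- The director `n* = (cos θ(z) cos tz, cos θ(z) sin tz, sin θ(z))`. -/
def profileDirector (t : ℝ) (θ : ℝ → ℝ) (p : Pt) : Vec :=
  !₂[Real.cos (θ (p 2)) * Real.cos (t * p 2), Real.cos (θ (p 2)) * Real.sin (t * p 2),
    Real.sin (θ (p 2))]

end Cholesteric

end

open MeasureTheory Filter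
open scoped Topology ContDiff

noncomputable section

namespace Cholesteric

/-! ### `L²` limits and functions of class `C¹` near a closed box -/

/-! Write `m` for the profile director and `v = n - m`. The density is quadratic in the field and
its gradient, so the energy excess of `n` is the first variation at `m` in the direction `v` plus
the integral of `|∇v|² + 2t v · ∇ × v`. The profile solves the Euler–Lagrange equation with
multiplier `λ = D - 2t² cos² θ ≤ D`. Both fields have unit length, so `2 m · v = -|v|²`, and the
multiplier contributes `-λ|v|² ≥ -D|v|²`. What remains of the first variation has the form `A · ∇v +
(div A) · v` and integrates to zero by Green's formula (`HasGradTrace.integral_inner_add`): `v`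
vanishes at `z = 0, 1`, and `A` depends on `z` only, so opposite lateral faces cancel by
periodicity.

Young's inequality gives `2t v · ∇ × v ≥ -k|∇v|² - (2t²/k)|v|²` for `0 < k ≤ 1` (this and the
previous algebra are `density_sub_density_ge`), and `HasGradTrace.poincare` bounds `∫|∂₂v|²` below
by `r² ∫|v|²` for every `r < π`. Hence (`energy_sub_energy_ge`) the excess is at least `((1-k) r² -
2t²/k - D) ∫|v|²`, and a positive coefficient yields both minimality and uniqueness. Since `D ≤ π²/4
+ t²`, letting `r → π` with `k = √2 t/π` makes the coefficient positive when `t² + 2√2 π t < 3π²/4`,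
that is for `t` below about `0.7668`. -/

theorem integrable_inner_of_memLp {α F : Type*} [MeasurableSpace α] {μ : Measure α}
    [NormedAddCommGroup F] [InnerProductSpace ℝ F] {u v : α → F} (hu : MemLp u 2 μ)
    (hv : MemLp v 2 μ) : Integrable (fun x => inner ℝ (u x) (v x)) μ := by
  refine (L2.integrable_inner (𝕜 := ℝ) (hu.toLp u) (hv.toLp v)).congr ?_
  filter_upwards [hu.coeFn_toLp, hv.coeFn_toLp] with x h1 h2
  rw [h1, h2]

/-- Continuity of the inner product of `L²`. It carries identities and inequalities for `C¹`
approximants over to Sobolev fields and their traces. -/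
theorem tendsto_integral_inner {α F : Type*} [MeasurableSpace α] {μ : Measure α}
    [NormedAddCommGroup F] [InnerProductSpace ℝ F]
    {f g : ℕ → α → F} {f₀ g₀ : α → F}
    (hf : ∀ k, MemLp (f k) 2 μ) (hg : ∀ k, MemLp (g k) 2 μ)
    (hf₀ : MemLp f₀ 2 μ) (hg₀ : MemLp g₀ 2 μ)
    (hfl : Tendsto (fun k => eLpNorm (f k - f₀) 2 μ) atTop (𝓝 0))
    (hgl : Tendsto (fun k => eLpNorm (g k - g₀) 2 μ) atTop (𝓝 0)) :
    Tendsto (fun k => ∫ x, inner ℝ (f k x) (g k x) ∂μ) atTop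
      (𝓝 (∫ x, inner ℝ (f₀ x) (g₀ x) ∂μ)) := by
  have key : ∀ {u v : α → F} (hu : MemLp u 2 μ) (hv : MemLp v 2 μ),
      ∫ x, inner ℝ (u x) (v x) ∂μ = inner ℝ (hu.toLp u) (hv.toLp v) := by
    intro u v hu hv
    rw [L2.inner_def]
    refine integral_congr_ae ?_
    filter_upwards [hu.coeFn_toLp, hv.coeFn_toLp] with x h1 h2
    rw [h1, h2]
  have h1 := (Lp.tendsto_Lp_iff_tendsto_eLpNorm'' f hf f₀ hf₀).2 hfl
  have h2 := (Lp.tendsto_Lp_iff_tendsto_eLpNorm'' g hg g₀ hg₀).2 hgl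
  rw [key hf₀ hg₀]
  simp_rw [fun k => key (hf k) (hg k)]
  exact h1.inner h2

theorem memLp_two_of_continuousOn {α F : Type*} [TopologicalSpace α] [MeasurableSpace α]
    [OpensMeasurableSpace α] [SecondCountableTopology α] [T2Space α] [NormedAddCommGroup F]
    {μ : Measure α} [IsFiniteMeasureOnCompacts μ] {s : Set α} (hs : IsCompact s) {f : α → F}
    (hf : ContinuousOn f s) : MemLp f 2 (μ.restrict s) := by
  obtain ⟨C, hC⟩ := hs.exists_bound_of_continuousOn hf
  have : IsFiniteMeasure (μ.restrict s) := ⟨by simpa using hs.measure_lt_top⟩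
  refine MemLp.of_bound (hf.aestronglyMeasurable_of_isCompact hs hs.measurableSet) C ?_
  filter_upwards [ae_restrict_mem hs.measurableSet] with x hx using hC x hx

theorem isOpen_box (a b : Pt) : IsOpen (box a b) :=
  isOpen_set_pi Set.finite_univ fun _ _ => isOpen_Ioo

theorem box_subset_Icc (a b : Pt) : box a b ⊆ Set.Icc a b := fun _ hp =>
  ⟨fun i => (hp i trivial).1.le, fun i => (hp i trivial).2.le⟩

theorem restrict_box (a b : Pt) :
    (volume : Measure Pt).restrict (box a b) = volume.restrict (Set.Icc a b) :=
  Measure.restrict_congr_set Measure.univ_pi_Ioo_ae_eq_Icc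

instance (a b : Pt) : IsFiniteMeasure ((volume : Measure Pt).restrict (box a b)) := by
  rw [restrict_box]
  exact ⟨by simpa using isCompact_Icc.measure_lt_top⟩

/-! ### Fields of class `C¹` up to the boundary of a box -/

section

variable {F : Type*} [NormedAddCommGroup F] [InnerProductSpace ℝ F]

/-- `w` is of class `C¹` near every point of the closed box with corners `a` and `b`. -/
def SmoothNear (a b : Pt) (w : Pt → F) : Prop := ∀ p ∈ Set.Icc a b, ContDiffAt ℝ 1 w p

theorem SmoothNear.continuousOn {a b : Pt} {w : Pt → F} (h : SmoothNear a b w) :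
    ContinuousOn w (Set.Icc a b) :=
  fun p hp => (h p hp).continuousAt.continuousWithinAt

theorem SmoothNear.continuousOn_pderiv {a b : Pt} {w : Pt → F} (h : SmoothNear a b w)
    (j : Fin 3) : ContinuousOn (pderiv j w) (Set.Icc a b) := fun p hp =>
  (((h p hp).continuousAt_fderiv one_ne_zero).clm_apply continuousAt_const).continuousWithinAt

theorem SmoothNear.hasFDerivAt {a b : Pt} {w : Pt → F} (h : SmoothNear a b w) {p : Pt}
    (hp : p ∈ Set.Icc a b) : HasFDerivAt w (fderiv ℝ w p) p :=
  ((h p hp).differentiableAt one_ne_zero).hasFDerivAt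

theorem SmoothNear.memLp {a b : Pt} {w : Pt → F} (h : SmoothNear a b w) :
    MemLp w 2 (volume.restrict (box a b)) := by
  rw [restrict_box]
  exact memLp_two_of_continuousOn isCompact_Icc h.continuousOn

theorem SmoothNear.memLp_pderiv {a b : Pt} {w : Pt → F} (h : SmoothNear a b w) (j : Fin 3) :
    MemLp (pderiv j w) 2 (volume.restrict (box a b)) := by
  rw [restrict_box]
  exact memLp_two_of_continuousOn isCompact_Icc (h.continuousOn_pderiv j)

theorem insertNth_mem_Icc {a b : Pt} (hab : a ≤ b) (i : Fin 3) (s : Bool) {y : Fin 2 → ℝ}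
    (hy : y ∈ Set.Icc (a ∘ i.succAbove) (b ∘ i.succAbove)) :
    i.insertNth (faceCoord a b i s) y ∈ Set.Icc a b := by
  constructor <;> intro j <;> rcases Fin.eq_self_or_eq_succAbove i j with rfl | ⟨k, rfl⟩
  · cases s <;> simp [faceCoord, hab j]
  · simpa using hy.1 k
  · cases s <;> simp [faceCoord, hab j]
  · simpa using hy.2 k

theorem SmoothNear.memLp_face {a b : Pt} (hab : a ≤ b) {w : Pt → F} (h : SmoothNear a b w)
    (i : Fin 3) (s : Bool) :
    MemLp (fun y => w (i.insertNth (faceCoord a b i s) y)) 2 (faceMeasure a b i) := by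
  refine memLp_two_of_continuousOn isCompact_Icc (h.continuousOn.comp ?_ ?_)
  · exact (Continuous.finInsertNth (A := fun _ => ℝ) i continuous_const continuous_id).continuousOn
  · exact fun y hy => insertNth_mem_Icc hab i s hy

theorem SmoothNear.sub {a b : Pt} {w z : Pt → F} (hw : SmoothNear a b w)
    (hz : SmoothNear a b z) : SmoothNear a b (w - z) := fun p hp => (hw p hp).sub (hz p hp)

theorem SmoothNear.inner_real {a b : Pt} {w z : Pt → F} (hw : SmoothNear a b w)
    (hz : SmoothNear a b z) : SmoothNear a b (fun p => inner ℝ (w p) (z p)) :=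
  fun p hp => (hw p hp).inner ℝ (hz p hp)

theorem SmoothNear.pderiv_sub {a b : Pt} {w z : Pt → F} (hw : SmoothNear a b w)
    (hz : SmoothNear a b z) (j : Fin 3) {p : Pt} (hp : p ∈ Set.Icc a b) :
    pderiv j (w - z) p = pderiv j w p - pderiv j z p := by
  simp [pderiv, ((hw.hasFDerivAt hp).sub (hz.hasFDerivAt hp)).fderiv]

theorem SmoothNear.pderiv_inner_real {a b : Pt} {w z : Pt → F} (hw : SmoothNear a b w)
    (hz : SmoothNear a b z) (j : Fin 3) {p : Pt} (hp : p ∈ Set.Icc a b) :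
    pderiv j (fun p => inner ℝ (w p) (z p)) p
      = inner ℝ (pderiv j w p) (z p) + inner ℝ (w p) (pderiv j z p) := by
  simp [pderiv, ((hw.hasFDerivAt hp).inner ℝ (hz.hasFDerivAt hp)).fderiv, add_comm]

theorem ae_mem_Icc (a b : Pt) : ∀ᵐ p ∂(volume : Measure Pt).restrict (box a b),
    p ∈ Set.Icc a b := by
  filter_upwards [ae_restrict_mem (isOpen_box a b).measurableSet] with p hp
    using box_subset_Icc a b hp

/-- The fundamental theorem of calculus on a box in the direction of a coordinate axis. -/
theorem integral_pderiv {a b : Pt} (hab : a ≤ b) {f : Pt → ℝ} (hf : SmoothNear a b f)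
    (j : Fin 3) :
    ∫ p in box a b, pderiv j f p
      = (∫ y, f (j.insertNth (faceCoord a b j true) y) ∂faceMeasure a b j)
        - ∫ y, f (j.insertNth (faceCoord a b j false) y) ∂faceMeasure a b j := by
  have h := integral_divergence_of_hasFDerivAt_off_countable' a b hab
    (fun i => if i = j then f else 0) (fun i => if i = j then fderiv ℝ f else 0) ∅
    Set.countable_empty
    (fun i => by
      split_ifs
      · exact hf.continuousOn
      · exact continuousOn_const)
    (fun p hp i => by
      split_ifs
      · exact hf.hasFDerivAt (box_subset_Icc a b hp.1)
      · exact hasFDerivAt_const 0 p)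
    (by
      have : (fun x : Pt => ∑ i, (if i = j then fderiv ℝ f else 0) x (Pi.single i 1))
          = pderiv j f := by
        funext x
        rw [Finset.sum_eq_single j] <;> simp +contextual [pderiv]
      rw [this]
      exact (hf.continuousOn_pderiv j).integrableOn_compact isCompact_Icc)
  rw [restrict_box]
  rw [Finset.sum_eq_single j (by simp +contextual) (by simp)] at h
  simp only [if_true] at h
  simp only [faceCoord, faceMeasure, if_true, Bool.false_eq_true, if_false]
  rw [← h]
  refine integral_congr_ae (Eventually.of_forall fun x => ?_)
  dsimp only
  rw [Finset.sum_eq_single j] <;> simp +contextual [pderiv]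

/-! ### Sobolev fields with gradients and traces; Green's formula -/

/-- `u` is a limit in `W^{1,2}` of `C¹` functions, with partial derivatives `g` and boundary
values `T`. -/
structure HasGradTrace (a b : Pt) (u : Pt → F) (g : Fin 3 → Pt → F)
    (T : Fin 3 → Bool → (Fin 2 → ℝ) → F) : Prop where
  memLp : MemLp u 2 (volume.restrict (box a b))
  memLp_grad : ∀ j, MemLp (g j) 2 (volume.restrict (box a b))
  memLp_trace : ∀ i s, MemLp (T i s) 2 (faceMeasure a b i)
  approx : ∃ w : ℕ → Pt → F, (∀ k, SmoothNear a b (w k)) ∧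
      Tendsto (fun k => eLpNorm (w k - u) 2 (volume.restrict (box a b))) atTop (𝓝 0) ∧
      (∀ j, Tendsto (fun k => eLpNorm (pderiv j (w k) - g j) 2
        (volume.restrict (box a b))) atTop (𝓝 0)) ∧
      ∀ i s, Tendsto (fun k => eLpNorm
        ((fun y => w k (i.insertNth (faceCoord a b i s) y)) - T i s) 2
        (faceMeasure a b i)) atTop (𝓝 0)

/-- A constant approximating sequence suffices. This lets the profile and its flux enter Green's
formula alongside an arbitrary admissible field. -/
theorem SmoothNear.hasGradTrace {a b : Pt} (hab : a ≤ b) {w : Pt → F} (h : SmoothNear a b w) :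
    HasGradTrace a b w (fun j => pderiv j w)
      (fun i s y => w (i.insertNth (faceCoord a b i s) y)) where
  memLp := h.memLp
  memLp_grad := h.memLp_pderiv
  memLp_trace := h.memLp_face hab
  approx := ⟨fun _ => w, fun _ => h, by simp, by simp, by simp⟩

theorem HasGradTrace.sub {a b : Pt} {u u' : Pt → F} {g g' : Fin 3 → Pt → F}
    {T T' : Fin 3 → Bool → (Fin 2 → ℝ) → F} (hab : a ≤ b) (h : HasGradTrace a b u g T)
    (h' : HasGradTrace a b u' g' T') :
    HasGradTrace a b (u - u') (fun j => g j - g' j) (fun i s => T i s - T' i s) where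
  memLp := h.memLp.sub h'.memLp
  memLp_grad j := (h.memLp_grad j).sub (h'.memLp_grad j)
  memLp_trace i s := (h.memLp_trace i s).sub (h'.memLp_trace i s)
  approx := by
    obtain ⟨w, hw, hwu, hwg, hwT⟩ := h.approx
    obtain ⟨z, hz, hzu, hzg, hzT⟩ := h'.approx
    have key : ∀ {α : Type} [MeasurableSpace α] {μ : Measure α} {f f' c : ℕ → α → F}
        {f₀ f₀' : α → F}, (∀ k, MemLp (f k) 2 μ) → (∀ k, MemLp (f' k) 2 μ) → MemLp f₀ 2 μ →
        MemLp f₀' 2 μ → Tendsto (fun k => eLpNorm (f k - f₀) 2 μ) atTop (𝓝 0) →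
        Tendsto (fun k => eLpNorm (f' k - f₀') 2 μ) atTop (𝓝 0) →
        (∀ k, c k =ᵐ[μ] f k - f' k) →
        Tendsto (fun k => eLpNorm (c k - (f₀ - f₀')) 2 μ) atTop (𝓝 0) := by
      intro α _ μ f f' c f₀ f₀' hf hf' hf₀ hf₀' h1 h2 hc
      refine tendsto_of_tendsto_of_tendsto_of_le_of_le tendsto_const_nhds
        (by simpa using h1.add h2) (fun _ => zero_le) fun k => ?_
      have : eLpNorm (c k - (f₀ - f₀')) 2 μ = eLpNorm ((f k - f₀) - (f' k - f₀')) 2 μ := by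
        refine eLpNorm_congr_ae ?_
        filter_upwards [hc k] with x hx
        simp only [Pi.sub_apply] at hx ⊢
        rw [hx]
        abel
      rw [this]
      exact eLpNorm_sub_le ((hf k).sub hf₀).1 ((hf' k).sub hf₀').1 (by norm_num)
    refine ⟨fun k => w k - z k, fun k => (hw k).sub (hz k), ?_, fun j => ?_, fun i s => ?_⟩
    · exact key (fun k => (hw k).memLp) (fun k => (hz k).memLp) h.memLp h'.memLp hwu hzu
        fun k => EventuallyEq.rfl
    · refine key (fun k => (hw k).memLp_pderiv j) (fun k => (hz k).memLp_pderiv j)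
        (h.memLp_grad j) (h'.memLp_grad j) (hwg j) (hzg j) fun k => ?_
      filter_upwards [ae_mem_Icc a b] with p hp using (hw k).pderiv_sub (hz k) j hp
    · exact key (fun k => (hw k).memLp_face hab i s) (fun k => (hz k).memLp_face hab i s)
        (h.memLp_trace i s) (h'.memLp_trace i s) (hwT i s) (hzT i s) fun k => EventuallyEq.rfl

/-- Green's formula on a box. -/
theorem HasGradTrace.integral_inner_add {a b : Pt} {u v : Pt → F} {g h : Fin 3 → Pt → F}
    {T S : Fin 3 → Bool → (Fin 2 → ℝ) → F} (hab : a ≤ b) (hu : HasGradTrace a b u g T)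
    (hv : HasGradTrace a b v h S) (j : Fin 3) :
    ∫ p in box a b, (inner ℝ (g j p) (v p) + inner ℝ (u p) (h j p))
      = (∫ y, inner ℝ (T j true y) (S j true y) ∂faceMeasure a b j)
        - ∫ y, inner ℝ (T j false y) (S j false y) ∂faceMeasure a b j := by
  obtain ⟨w, hw, hwu, hwg, hwT⟩ := hu.approx
  obtain ⟨z, hz, hzu, hzg, hzT⟩ := hv.approx
  have h1 := (tendsto_integral_inner (fun k => (hw k).memLp_pderiv j) (fun k => (hz k).memLp)
    (hu.memLp_grad j) hv.memLp (hwg j) hzu).add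
    (tendsto_integral_inner (fun k => (hw k).memLp) (fun k => (hz k).memLp_pderiv j)
    hu.memLp (hv.memLp_grad j) hwu (hzg j))
  have h2 : ∀ s, _ := fun s => tendsto_integral_inner (fun k => (hw k).memLp_face hab j s)
    (fun k => (hz k).memLp_face hab j s) (hu.memLp_trace j s) (hv.memLp_trace j s)
    (hwT j s) (hzT j s)
  have h3 := (h2 true).sub (h2 false)
  rw [integral_add (integrable_inner_of_memLp (hu.memLp_grad j) hv.memLp)
    (integrable_inner_of_memLp hu.memLp (hv.memLp_grad j))]
  -- Both sides are limits of the two sides of the classical formula for the approximants.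
  refine tendsto_nhds_unique h1 (h3.congr fun k => ?_)
  rw [← integral_pderiv hab ((hw k).inner_real (hz k)) j,
    ← integral_add (integrable_inner_of_memLp ((hw k).memLp_pderiv j) (hz k).memLp)
    (integrable_inner_of_memLp (hw k).memLp ((hz k).memLp_pderiv j))]
  refine integral_congr_ae ?_
  filter_upwards [ae_mem_Icc a b] with p hp using (hw k).pderiv_inner_real (hz k) j hp

end

/-! ### Weak derivatives of smooth functions -/

section

variable {F : Type*} [NormedAddCommGroup F] [NormedSpace ℝ F]

theorem hasFDerivAt_comp_coord {q : ℝ → F} {q' : F} {p : Pt} (h : HasDerivAt q q' (p 2)) :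
    HasFDerivAt (fun p : Pt => q (p 2))
      ((ContinuousLinearMap.proj (R := ℝ) (φ := fun _ : Fin 3 => ℝ) 2).smulRight q') p := by
  have h1 : HasFDerivAt (fun p : Pt => p 2)
    (ContinuousLinearMap.proj (R := ℝ) (φ := fun _ : Fin 3 => ℝ) 2) p := hasFDerivAt_apply 2 p
  refine (HasFDerivAt.comp p h.hasFDerivAt h1).congr_fderiv ?_
  ext; simp

theorem pderiv_two_comp_coord {q : ℝ → F} {q' : F} {p : Pt} (h : HasDerivAt q q' (p 2)) :
    pderiv 2 (fun p : Pt => q (p 2)) p = q' := by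
  simp [pderiv, (hasFDerivAt_comp_coord h).fderiv]

theorem pderiv_comp_coord_of_ne {q : ℝ → F} {q' : F} {p : Pt} (h : HasDerivAt q q' (p 2))
    {j : Fin 3} (hj : j ≠ 2) : pderiv j (fun p : Pt => q (p 2)) p = 0 := by
  simp [pderiv, (hasFDerivAt_comp_coord h).fderiv, Pi.single_eq_of_ne hj.symm]

/-- Agreement on `U` alone is assumed because a profile `θ` is arbitrary outside `[0, 1]`, where
only its smooth extension is under control. -/
theorem isWeakPartial_pderiv {U : Set Pt} (hU : IsOpen U) {u v : Pt → F} (hv : ContDiff ℝ 1 v)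
    (huv : Set.EqOn u v U) (j : Fin 3) : IsWeakPartial U j u (pderiv j v) := by
  have hc : Continuous (pderiv j v) :=
    (hv.continuous_fderiv one_ne_zero).clm_apply continuous_const
  refine ⟨?_, hc.locallyIntegrable.locallyIntegrableOn U, fun φ hφ hφc hφU => ?_⟩
  · refine LocallyIntegrableOn.congr ?_ (hv.continuous.locallyIntegrable.locallyIntegrableOn U)
    filter_upwards [ae_restrict_mem hU.measurableSet] with p hp using (huv hp).symm
  have hφ0 : ∀ p ∉ U, φ p = 0 := fun p hp => image_eq_zero_of_notMem_tsupport fun h => hp (hφU h)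
  have hsupp : tsupport (pderiv j φ) ⊆ tsupport φ := tsupport_fderiv_apply_subset ℝ _
  have hφ0' : ∀ p ∉ U, pderiv j φ p = 0 := fun p hp =>
    image_eq_zero_of_notMem_tsupport fun h => hp (hφU (hsupp h))
  have hφ'c : Continuous (pderiv j φ) :=
    (hφ.continuous_fderiv (by simp)).clm_apply continuous_const
  have hφ'cs : HasCompactSupport (pderiv j φ) := hφc.fderiv_apply ℝ _
  have h := integral_smul_fderiv_eq_neg_fderiv_smul_of_integrable (μ := (volume : Measure Pt))
    (f := φ) (g := v) (v := Pi.single j 1)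
    ((hφ'c.smul hv.continuous).integrable_of_hasCompactSupport hφ'cs.smul_right)
    ((hφ.continuous.smul hc).integrable_of_hasCompactSupport hφc.smul_right)
    ((hφ.continuous.smul hv.continuous).integrable_of_hasCompactSupport hφc.smul_right)
    (fun x _ => hφ.differentiable (by simp) x) (fun x _ => hv.differentiable one_ne_zero x)
  rw [setIntegral_congr_fun (g := fun p => pderiv j φ p • v p) hU.measurableSet
    (fun p hp => by simp only [huv hp])]
  rw [setIntegral_eq_integral_of_forall_compl_eq_zero fun p hp => by rw [hφ0' p hp, zero_smul],
    setIntegral_eq_integral_of_forall_compl_eq_zero fun p hp => by rw [hφ0 p hp, zero_smul]]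
  simp only [pderiv]
  rw [h, neg_neg]

/-- The fundamental lemma of the calculus of variations. It is needed because `weakPartial` is an
arbitrary choice among weak derivatives. -/
theorem IsWeakPartial.ae_eq [FiniteDimensional ℝ F] {U : Set Pt} (hU : IsOpen U) {j : Fin 3}
    {u g g' : Pt → F}
    (h : IsWeakPartial U j u g) (h' : IsWeakPartial U j u g') : g =ᵐ[volume.restrict U] g' := by
  have := hU.ae_eq_zero_of_integral_contDiff_smul_eq_zero (μ := volume) (f := g - g')
    (h.2.1.sub h'.2.1) fun φ hφ hφc hφU => ?_
  · filter_upwards [(ae_restrict_iff' hU.measurableSet).2 this] with p hp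
    exact sub_eq_zero.1 hp
  have hint : ∀ k : Pt → F, LocallyIntegrableOn k U volume →
      IntegrableOn (fun p => φ p • k p) U := by
    intro k hk
    have h1 : IntegrableOn (fun p => φ p • k p) (tsupport φ) :=
      (hk.integrableOn_compact_subset hφU hφc).continuousOn_smul hφ.continuous.continuousOn hφc
    exact ((integrableOn_iff_integrable_of_support_subset
      ((Function.support_smul_subset_left φ k).trans (subset_tsupport φ))).1 h1).integrableOn
  have e1 := h.2.2 φ hφ hφc hφU
  have e2 := h'.2.2 φ hφ hφc hφU
  have e3 : ∫ p in U, φ p • g p = ∫ p in U, φ p • g' p := neg_inj.1 (e1.symm.trans e2)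
  rw [← setIntegral_eq_integral_of_forall_compl_eq_zero (s := U) fun p hp => by
    rw [image_eq_zero_of_notMem_tsupport fun h => hp (hφU h), zero_smul]]
  simp only [Pi.sub_apply, smul_sub]
  rw [integral_sub (hint g h.2.1) (hint g' h'.2.1), e3, sub_self]

theorem isWeakPartial_weakPartial {U : Set Pt} {j : Fin 3} {u : Pt → F}
    (h : ∃ g, IsWeakPartial U j u g) : IsWeakPartial U j u (weakPartial U j u) := by
  rw [weakPartial, dif_pos h]
  exact h.choose_spec

theorem weakPartial_ae_eq_pderiv [FiniteDimensional ℝ F] {U : Set Pt} (hU : IsOpen U)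
    {u v : Pt → F} (hv : ContDiff ℝ 1 v) (huv : Set.EqOn u v U) (j : Fin 3) :
    weakPartial U j u =ᵐ[volume.restrict U] pderiv j v :=
  (isWeakPartial_weakPartial ⟨_, isWeakPartial_pderiv hU hv huv j⟩).ae_eq hU
    (isWeakPartial_pderiv hU hv huv j)

end

/-! ### The Poincaré inequality in the third coordinate -/

section

variable {F : Type*} [NormedAddCommGroup F] [InnerProductSpace ℝ F]

/-- The Poincaré inequality, with a constant as close as desired to the optimal one, for a function
which vanishes on two opposite faces. The proof completes the square in
`|∂₂ v + τ v|²`, where `τ = r tan (r (z - 1/2))`. -/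
theorem HasGradTrace.poincare {a b : Pt} (hab : a ≤ b) (ha : a 2 = 0) (hb : b 2 = 1) {v : Pt → F}
    {g : Fin 3 → Pt → F} {S : Fin 3 → Bool → (Fin 2 → ℝ) → F} (hv : HasGradTrace a b v g S)
    (hS : ∀ s, S 2 s =ᵐ[faceMeasure a b 2] 0) {r : ℝ} (hr : 0 < r) (hrπ : r < Real.pi) :
    r ^ 2 * ∫ p in box a b, ‖v p‖ ^ 2 ≤ ∫ p in box a b, ‖g 2 p‖ ^ 2 := by
  obtain ⟨w, hw, hwv, hwg, hwS⟩ := hv.approx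
  set τ : ℝ → ℝ := fun z => r * Real.tan (r * (z - 1 / 2)) with hτ
  have hcos : ∀ p ∈ Set.Icc a b, Real.cos (r * (p 2 - 1 / 2)) ≠ 0 := by
    intro p hp
    have h0 : 0 ≤ p 2 := ha ▸ hp.1 2
    have h1 : p 2 ≤ 1 := hb ▸ hp.2 2
    exact (Real.cos_pos_of_mem_Ioo ⟨by nlinarith, by nlinarith⟩).ne'
  have hτd : ∀ p ∈ Set.Icc a b, HasDerivAt τ (r ^ 2 + τ (p 2) ^ 2) (p 2) := by
    intro p hp
    have h1 : HasDerivAt (fun z : ℝ => r * (z - 1 / 2)) r (p 2) := by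
      simpa only [id_eq, mul_one] using ((hasDerivAt_id (p 2)).sub_const (1 / 2)).const_mul r
    have h2 := ((Real.hasDerivAt_tan (hcos p hp)).comp (p 2) h1).const_mul r
    refine h2.congr_deriv ?_
    simp only [hτ]
    rw [one_div, ← Real.inv_one_add_tan_sq (hcos p hp), inv_inv]
    ring
  -- The tangent has poles off the box, so smoothness is available only near the closed box.
  have hτs : SmoothNear a b (fun p => τ (p 2)) := by
    intro p hp
    have h1 : ContDiffAt ℝ 1 (fun p : Pt => r * (p 2 - 1 / 2)) p := by fun_prop
    exact contDiffAt_const.mul (ContDiffAt.comp (g := Real.tan) p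
      (Real.contDiffAt_tan.2 (hcos p hp)) h1)
  have hτw : ∀ k, SmoothNear a b (fun p => τ (p 2) • w k p) := fun k p hp =>
    (hτs p hp).smul (hw k p hp)
  have hpd : ∀ k, ∀ p ∈ Set.Icc a b, pderiv 2 (fun p => τ (p 2) • w k p) p
      = τ (p 2) • pderiv 2 (w k) p + (r ^ 2 + τ (p 2) ^ 2) • w k p := by
    intro k p hp
    have h1 := pderiv_two_comp_coord (hτd p hp)
    have h2 := ((hτs.hasFDerivAt hp).smul ((hw k).hasFDerivAt hp)).fderiv
    simp only [pderiv] at h1 ⊢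
    erw [h2]
    simp [h1]
  -- The values of `τ` at `z = 1` and `z = 0` are `κ` and `-κ`. The approximants need not vanish on
  -- these faces, so their boundary term is kept and disappears only in the limit.
  set κ : ℝ := r * Real.tan (r / 2) with hκ
  have hf : ∀ s, ∀ y : Fin 2 → ℝ, τ ((2 : Fin 3).insertNth (α := fun _ => ℝ) (faceCoord a b 2 s) y 2)
      = if s then κ else -κ := by
    intro s y
    rw [Fin.insertNth_apply_same]
    cases s
    · simp only [faceCoord, ha, hτ, hκ, Bool.false_eq_true, if_false]
      rw [show r * (0 - 1 / 2) = -(r / 2) by ring, Real.tan_neg, mul_neg]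
    · simp only [faceCoord, hb, hτ, hκ, if_true]
      rw [show r * (1 - 1 / 2) = r / 2 by ring]
  have key : ∀ k, r ^ 2 * ∫ p in box a b, inner ℝ (w k p) (w k p)
      ≤ (∫ p in box a b, inner ℝ (pderiv 2 (w k) p) (pderiv 2 (w k) p))
      + κ * ((∫ y, inner ℝ (w k ((2 : Fin 3).insertNth (faceCoord a b 2 true) y))
          (w k ((2 : Fin 3).insertNth (faceCoord a b 2 true) y)) ∂faceMeasure a b 2)
        + ∫ y, inner ℝ (w k ((2 : Fin 3).insertNth (faceCoord a b 2 false) y))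
          (w k ((2 : Fin 3).insertNth (faceCoord a b 2 false) y)) ∂faceMeasure a b 2) := by
    intro k
    have h1 := integral_pderiv hab ((hw k).inner_real (hτw k)) 2
    simp only [inner_smul_right, hf, if_true, Bool.false_eq_true, if_false] at h1
    rw [integral_const_mul, integral_const_mul] at h1
    have i1 := integrable_inner_of_memLp (hw k).memLp (hw k).memLp
    have i2 := integrable_inner_of_memLp ((hw k).memLp_pderiv 2) ((hw k).memLp_pderiv 2)
    have i3 : Integrable (pderiv 2 fun p => τ (p 2) * inner ℝ (w k p) (w k p))
        (volume.restrict (box a b)) := by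
      have hs : SmoothNear a b (fun p => τ (p 2) * inner ℝ (w k p) (w k p)) := fun p hp =>
        (hτs p hp).mul ((hw k).inner_real (hw k) p hp)
      exact (hs.memLp_pderiv 2).integrable (by norm_num)
    -- By the Riccati equation the integrand equals `|∂₂w + τ w|²`.
    have h2 : 0 ≤ ∫ p in box a b, (inner ℝ (pderiv 2 (w k) p) (pderiv 2 (w k) p)
        - r ^ 2 * inner ℝ (w k p) (w k p)
        + pderiv 2 (fun p => τ (p 2) * inner ℝ (w k p) (w k p)) p) := by
      refine integral_nonneg_of_ae ?_
      filter_upwards [ae_mem_Icc a b] with p hp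
      have e1 := (hw k).pderiv_inner_real (hτw k) 2 hp
      simp only [inner_smul_right] at e1
      rw [e1, hpd k p hp]
      have e2 := real_inner_self_nonneg (x := pderiv 2 (w k) p + τ (p 2) • w k p)
      simp only [inner_add_left, inner_add_right, inner_smul_left, inner_smul_right,
        real_inner_comm (pderiv 2 (w k) p) (w k p), RCLike.conj_to_real, Pi.zero_apply] at e2 ⊢
      nlinarith [e2]
    rw [integral_add (f := fun p => inner ℝ (pderiv 2 (w k) p) (pderiv 2 (w k) p)
        - r ^ 2 * inner ℝ (w k p) (w k p)) (i2.sub (i1.const_mul _)) i3,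
      integral_sub i2 (i1.const_mul _),
      integral_const_mul, h1] at h2
    linarith
  have l1 := (tendsto_integral_inner (fun k => (hw k).memLp) (fun k => (hw k).memLp) hv.memLp
    hv.memLp hwv hwv).const_mul (r ^ 2)
  have l2 := tendsto_integral_inner (fun k => (hw k).memLp_pderiv 2)
    (fun k => (hw k).memLp_pderiv 2) (hv.memLp_grad 2) (hv.memLp_grad 2) (hwg 2) (hwg 2)
  have l3 : ∀ s, _ := fun s => tendsto_integral_inner (fun k => (hw k).memLp_face hab 2 s)
    (fun k => (hw k).memLp_face hab 2 s) (hv.memLp_trace 2 s) (hv.memLp_trace 2 s)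
    (hwS 2 s) (hwS 2 s)
  have h0 : ∀ s, ∫ y, inner ℝ (S 2 s y) (S 2 s y) ∂faceMeasure a b 2 = 0 := by
    intro s
    refine integral_eq_zero_of_ae ?_
    filter_upwards [hS s] with y hy
    simp [hy]
  have l4 := l2.add (((l3 true).add (l3 false)).const_mul κ)
  rw [h0, h0, add_zero, mul_zero, add_zero] at l4
  have := le_of_tendsto_of_tendsto' l1 l4 key
  simpa only [real_inner_self_eq_norm_sq] using this

end

/-! ### The one-variable problem -/

theorem profile_radicand_pos {t D : ℝ} (h : t ^ 2 < D) (u : ℝ) :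
    0 < D - t ^ 2 * Real.cos u ^ 2 := by
  nlinarith [Real.cos_sq_le_one u, sq_nonneg t]

theorem contDiff_profile_integrand {t D : ℝ} (h : t ^ 2 < D) :
    ContDiff ℝ ∞ fun u => 1 / √(D - t ^ 2 * Real.cos u ^ 2) := by
  refine contDiff_const.div (ContDiff.sqrt ?_ fun u => (profile_radicand_pos h u).ne')
    fun u => (Real.sqrt_pos.2 (profile_radicand_pos h u)).ne'
  exact contDiff_const.sub (contDiff_const.mul (Real.contDiff_cos.pow 2))

theorem inv_sqrt_le_profile_integrand {t D : ℝ} (h : t ^ 2 < D) (u : ℝ) :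
    1 / √D ≤ 1 / √(D - t ^ 2 * Real.cos u ^ 2) :=
  one_div_le_one_div_of_le (Real.sqrt_pos.2 (profile_radicand_pos h u))
    (Real.sqrt_le_sqrt (by nlinarith [mul_nonneg (sq_nonneg t) (sq_nonneg (Real.cos u))]))

/-- Replacing `cos² u` by `1` enlarges the integrand, so `1 ≤ (π/2) / √(D - t²)`. -/
theorem IsProfileConstant.le {t D : ℝ} (h : IsProfileConstant t D) :
    D ≤ Real.pi ^ 2 / 4 + t ^ 2 := by
  have hpos : 0 < D - t ^ 2 := sub_pos.2 h.1
  have h1 : (1 : ℝ) ≤ ∫ _ in (0 : ℝ)..(Real.pi / 2), 1 / √(D - t ^ 2) := by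
    conv_lhs => rw [← h.2]
    refine intervalIntegral.integral_mono_on (by positivity)
      ((contDiff_profile_integrand h.1).continuous.intervalIntegrable _ _)
      intervalIntegrable_const fun u _ => ?_
    exact one_div_le_one_div_of_le (Real.sqrt_pos.2 hpos)
      (Real.sqrt_le_sqrt (by nlinarith [Real.cos_sq_le_one u, sq_nonneg t]))
  rw [intervalIntegral.integral_const, smul_eq_mul, sub_zero, mul_one_div,
    le_div_iff₀ (Real.sqrt_pos.2 hpos), one_mul] at h1
  have h2 := Real.sqrt_le_left (by positivity) |>.1 h1
  nlinarith

theorem IsProfileConstant.le_of {t D D' : ℝ} (h : IsProfileConstant t D)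
    (h' : IsProfileConstant t D') : D ≤ D' := by
  by_contra! hlt
  have : ∫ u in (0 : ℝ)..(Real.pi / 2), 1 / √(D - t ^ 2 * Real.cos u ^ 2)
      < ∫ u in (0 : ℝ)..(Real.pi / 2), 1 / √(D' - t ^ 2 * Real.cos u ^ 2) := by
    have hl : ∀ u : ℝ, 1 / √(D - t ^ 2 * Real.cos u ^ 2)
        < 1 / √(D' - t ^ 2 * Real.cos u ^ 2) := fun u =>
      one_div_lt_one_div_of_lt (Real.sqrt_pos.2 (profile_radicand_pos h'.1 u))
        (Real.sqrt_lt_sqrt (profile_radicand_pos h'.1 u).le (by linarith))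
    exact intervalIntegral.integral_lt_integral_of_continuousOn_of_le_of_exists_lt
      (by positivity) (contDiff_profile_integrand h.1).continuous.continuousOn
      (contDiff_profile_integrand h'.1).continuous.continuousOn (fun u _ => (hl u).le)
      ⟨0, ⟨le_rfl, by positivity⟩, hl 0⟩
  rw [h.2, h'.2] at this
  exact lt_irrefl _ this

/-- The integral is at least `1` at `D = π²/4` and at most `1` at `D = π²/4 + t²`; the intermediate
value theorem applies in between. Uniqueness is the strict monotonicity in `D` behind
`IsProfileConstant.le_of`. -/
theorem existsUnique_isProfileConstant {t : ℝ} (ht : t ^ 2 < Real.pi ^ 2 / 4) :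
    ∃! D, IsProfileConstant t D := by
  set D₀ : ℝ := Real.pi ^ 2 / 4 with hD₀
  have hε : 0 < D₀ - t ^ 2 := sub_pos.2 ht
  -- Truncating the radicand from below makes the integrand jointly continuous on the whole plane,
  -- and changes nothing for `D ≥ D₀`.
  let f : ℝ → ℝ → ℝ := fun D u => 1 / √(max (D - t ^ 2 * Real.cos u ^ 2) (D₀ - t ^ 2))
  have hf : Continuous (Function.uncurry f) := by
    refine Continuous.div continuous_const (by fun_prop) fun p => ?_
    exact (Real.sqrt_pos.2 (lt_max_of_lt_right hε)).ne'
  have hcont := intervalIntegral.continuous_parametric_intervalIntegral_of_continuous'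
    (μ := volume) hf 0 (Real.pi / 2)
  have heq : ∀ D, D₀ ≤ D → ∀ u, f D u = 1 / √(D - t ^ 2 * Real.cos u ^ 2) := by
    intro D hD u
    simp only [f]
    rw [max_eq_left]
    nlinarith [Real.cos_sq_le_one u, sq_nonneg t]
  have hge : 1 ≤ ∫ u in (0 : ℝ)..(Real.pi / 2), f D₀ u := by
    have h1 : (1 : ℝ) = ∫ _ in (0 : ℝ)..(Real.pi / 2), 1 / √D₀ := by
      rw [intervalIntegral.integral_const, smul_eq_mul, sub_zero, hD₀,
        show Real.pi ^ 2 / 4 = (Real.pi / 2) ^ 2 by ring, Real.sqrt_sq (by positivity)]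
      field_simp
    rw [h1]
    refine intervalIntegral.integral_mono_on (by positivity) intervalIntegrable_const
      ((hf.comp (Continuous.prodMk_right D₀)).intervalIntegrable _ _) fun u _ => ?_
    simp only [heq D₀ le_rfl u]
    exact inv_sqrt_le_profile_integrand ht u
  have hle : ∫ u in (0 : ℝ)..(Real.pi / 2), f (D₀ + t ^ 2) u ≤ 1 := by
    have h1 : (1 : ℝ) = ∫ _ in (0 : ℝ)..(Real.pi / 2), 1 / √D₀ := by
      rw [intervalIntegral.integral_const, smul_eq_mul, sub_zero, hD₀,
        show Real.pi ^ 2 / 4 = (Real.pi / 2) ^ 2 by ring, Real.sqrt_sq (by positivity)]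
      field_simp
    conv_rhs => rw [h1]
    refine intervalIntegral.integral_mono_on (by positivity)
      ((hf.comp (Continuous.prodMk_right (D₀ + t ^ 2))).intervalIntegrable _ _)
      intervalIntegrable_const fun u _ => ?_
    simp only [heq (D₀ + t ^ 2) (by nlinarith [sq_nonneg t]) u]
    exact one_div_le_one_div_of_le (Real.sqrt_pos.2 (by positivity))
      (Real.sqrt_le_sqrt (by nlinarith [Real.cos_sq_le_one u, sq_nonneg t]))
  obtain ⟨D, hD, hD1⟩ := intermediate_value_Icc' (f := fun D => ∫ u in (0 : ℝ)..(Real.pi / 2), f D u)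
    (show D₀ ≤ D₀ + t ^ 2 by nlinarith [sq_nonneg t]) hcont.continuousOn ⟨hle, hge⟩
  have hprof : IsProfileConstant t D := by
    refine ⟨ht.trans_le hD.1, ?_⟩
    simp only [heq D hD.1] at hD1
    exact hD1
  exact ⟨D, hprof, fun D' hD' => le_antisymm (hD'.le_of hprof) (hprof.le_of hD')⟩

/-- `Θ` is the inverse of the primitive `G` of the integrand, which is smooth and strictly
increasing. Inverting on all of `ℝ` makes the director smooth beyond the closed box, and injectivity
of `G` forces every profile to agree with `Θ` on `[0, 1]`. -/
theorem exists_smooth_profile {t D : ℝ} (h : t ^ 2 < D) :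
    ∃ Θ : ℝ → ℝ, ContDiff ℝ ∞ Θ ∧
      (∀ z, ∫ u in (0 : ℝ)..(Θ z), 1 / √(D - t ^ 2 * Real.cos u ^ 2) = z) ∧
      (∀ y z, ∫ u in (0 : ℝ)..y, 1 / √(D - t ^ 2 * Real.cos u ^ 2) = z → y = Θ z) ∧
      ∀ z, HasDerivAt Θ (√(D - t ^ 2 * Real.cos (Θ z) ^ 2)) z := by
  set g : ℝ → ℝ := fun u => 1 / √(D - t ^ 2 * Real.cos u ^ 2) with hg
  have hgs : ContDiff ℝ ∞ g := contDiff_profile_integrand h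
  have hDpos : 0 < D := (sq_nonneg t).trans_lt h
  have hgpos : ∀ u, 0 < g u := fun u =>
    one_div_pos.2 (Real.sqrt_pos.2 (profile_radicand_pos h u))
  set G : ℝ → ℝ := fun y => ∫ u in (0 : ℝ)..y, g u with hG
  have hGd : ∀ y, HasDerivAt G (g y) y := fun y =>
    intervalIntegral.integral_hasDerivAt_right (hgs.continuous.intervalIntegrable _ _)
      (hgs.continuous.stronglyMeasurableAtFilter _ _) hgs.continuous.continuousAt
  have hGmono : StrictMono G := strictMono_of_deriv_pos fun y => by
    rw [(hGd y).deriv]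
    exact hgpos y
  have hGs : ContDiff ℝ ∞ G := by
    rw [contDiff_infty_iff_deriv]
    refine ⟨fun y => (hGd y).differentiableAt, ?_⟩
    rwa [show deriv G = g from funext fun y => (hGd y).deriv]
  have hc : 0 < 1 / √D := one_div_pos.2 (Real.sqrt_pos.2 hDpos)
  -- `G' ≥ 1/√D` gives linear growth at both ends, hence surjectivity.
  have hmono : Monotone fun y => G y - 1 / √D * y := by
    refine monotone_of_deriv_nonneg (hGs.differentiable (by simp) |>.sub (by fun_prop)) fun y => ?_
    have h1 : HasDerivAt (fun y => G y - 1 / √D * y) (g y - 1 / √D) y :=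
      ((hGd y).sub ((hasDerivAt_id y).const_mul (1 / √D))).congr_deriv (by rw [mul_one])
    rw [h1.deriv]
    exact sub_nonneg.2 (inv_sqrt_le_profile_integrand h y)
  have hG0 : G 0 = 0 := by simp [hG]
  have htop : Tendsto G atTop atTop := by
    refine tendsto_atTop_mono' atTop ?_ (tendsto_id.const_mul_atTop hc)
    filter_upwards [eventually_ge_atTop 0] with y hy
    have := hmono hy
    simp only [hG0] at this
    simp only [id_eq]
    linarith
  have hbot : Tendsto G atBot atBot := by
    refine tendsto_atBot_mono' atBot ?_ (tendsto_id.const_mul_atBot hc)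
    filter_upwards [eventually_le_atBot 0] with y hy
    have := hmono hy
    simp only [hG0] at this
    simp only [id_eq]
    linarith
  let e : ℝ ≃ₜ ℝ :=
    (hGmono.orderIsoOfSurjective G (hGs.continuous.surjective htop hbot)).toHomeomorph
  have he : ∀ y, e y = G y := fun _ => rfl
  have hes : ∀ z, G (e.symm z) = z := fun z => e.apply_symm_apply z
  refine ⟨e.symm, e.contDiff_symm_deriv (f' := g) (fun x => (hgpos x).ne') hGd hGs, hes,
    fun y z hyz => hGmono.injective ((show G y = z from hyz).trans (hes z).symm), fun z => ?_⟩
  have := (hGd (e.symm z)).of_local_left_inverse (g := e.symm) e.symm.continuous.continuousAt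
    (hgpos _).ne' (Eventually.of_forall hes)
  simpa only [hg, one_div, inv_inv] using this

/-- The equation for `Θ'` is a first integral of the second-order equation `Θ'' = t² cos Θ sin Θ`.
-/
theorem hasDerivAt_profile_deriv {t D : ℝ} (h : t ^ 2 < D) {Θ : ℝ → ℝ} {z : ℝ}
    (hΘ : HasDerivAt Θ (√(D - t ^ 2 * Real.cos (Θ z) ^ 2)) z) :
    HasDerivAt (fun z => √(D - t ^ 2 * Real.cos (Θ z) ^ 2))
      (t ^ 2 * Real.cos (Θ z) * Real.sin (Θ z)) z := by
  have hpos := profile_radicand_pos h (Θ z)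
  have h1 := (((hΘ.cos.pow 2).const_mul (t ^ 2)).const_sub D).sqrt hpos.ne'
  refine h1.congr_deriv ?_
  have := (Real.sqrt_pos.2 hpos).ne'
  simp only [Pi.pow_apply]
  field_simp
  simp
  ring

/-! ### The director of the profile and the energy density -/

theorem hasDerivAt_vec {f₀ f₁ f₂ : ℝ → ℝ} {d₀ d₁ d₂ z : ℝ} (h₀ : HasDerivAt f₀ d₀ z)
    (h₁ : HasDerivAt f₁ d₁ z) (h₂ : HasDerivAt f₂ d₂ z) :
    HasDerivAt (fun z => (!₂[f₀ z, f₁ z, f₂ z] : Vec)) !₂[d₀, d₁, d₂] z := by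
  rw [hasDerivAt_iff_hasFDerivAt, ← hasFDerivWithinAt_univ, hasFDerivWithinAt_euclidean]
  intro i
  rw [hasFDerivWithinAt_univ]
  fin_cases i
  · refine h₀.hasFDerivAt.congr_fderiv ?_
    ext; simp
  · refine h₁.hasFDerivAt.congr_fderiv ?_
    ext; simp
  · refine h₂.hasFDerivAt.congr_fderiv ?_
    ext; simp

theorem contDiff_vec {E : Type*} [NormedAddCommGroup E] [NormedSpace ℝ E] {n : WithTop ℕ∞}
    {f₀ f₁ f₂ : E → ℝ} (h₀ : ContDiff ℝ n f₀)
    (h₁ : ContDiff ℝ n f₁) (h₂ : ContDiff ℝ n f₂) :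
    ContDiff ℝ n (fun z => (!₂[f₀ z, f₁ z, f₂ z] : Vec)) := by
  rw [contDiff_euclidean]
  intro i
  fin_cases i
  · exact h₀
  · exact h₁
  · exact h₂

/-- The director `n*` on the line, when `θ` and `θ'` take the values `a` and `b` at `z`. -/
def dir (t a z : ℝ) : Vec :=
  !₂[Real.cos a * Real.cos (t * z), Real.cos a * Real.sin (t * z), Real.sin a]

/-- The derivative of `dir`. -/
def dirDeriv (t a b z : ℝ) : Vec :=
  !₂[-(Real.sin a * b * Real.cos (t * z)) - t * Real.cos a * Real.sin (t * z),
    -(Real.sin a * b * Real.sin (t * z)) + t * Real.cos a * Real.cos (t * z), Real.cos a * b]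

/-- The coefficient of `∂ⱼ v` in half the first variation of the energy at the director, in the
direction `v`, after the terms without derivatives have been split off. -/
def flux (t a b z : ℝ) (j : Fin 3) : Vec :=
  ![!₂[0, t * Real.sin a, -(t * (Real.cos a * Real.sin (t * z)))],
    !₂[-(t * Real.sin a), 0, t * (Real.cos a * Real.cos (t * z))],
    !₂[-(Real.sin a * b * Real.cos (t * z)), -(Real.sin a * b * Real.sin (t * z)),
      Real.cos a * b]] j

/-- The derivative of `flux` in the direction of the third axis. -/
def fluxDeriv (t a b z : ℝ) : Vec :=
  !₂[-((Real.cos a * b ^ 2 + Real.sin a * (t ^ 2 * Real.cos a * Real.sin a)) * Real.cos (t * z))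
      + t * (Real.sin a * b * Real.sin (t * z)),
    -((Real.cos a * b ^ 2 + Real.sin a * (t ^ 2 * Real.cos a * Real.sin a)) * Real.sin (t * z))
      - t * (Real.sin a * b * Real.cos (t * z)),
    -(Real.sin a * b ^ 2) + Real.cos a * (t ^ 2 * Real.cos a * Real.sin a)]

/-- The energy density at a value `m` of the field and values `d j` of its derivatives. -/
def density (t : ℝ) (m : Vec) (d : Fin 3 → Vec) : ℝ :=
  (∑ j, ‖d j‖ ^ 2) + 2 * t * inner ℝ m (curl d) + t ^ 2

theorem norm_dir (t a z : ℝ) : ‖dir t a z‖ = 1 := by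
  rw [← sq_eq_sq₀ (norm_nonneg _) zero_le_one, EuclideanSpace.norm_sq_eq]
  simp only [dir, Fin.sum_univ_three, Real.norm_eq_abs, sq_abs, PiLp.toLp_apply,
    Matrix.cons_val_zero, Matrix.cons_val_one, Matrix.cons_val]
  linear_combination Real.cos a ^ 2 * Real.sin_sq_add_cos_sq (t * z) + Real.sin_sq_add_cos_sq a

/-- The excess of the energy density, as far as it is not the first variation, is bounded below by
a quadratic form in the difference of the fields. -/
theorem density_sub_density_ge {t D a b z k : ℝ} (hk : 0 < k) (hk1 : k ≤ 1)
    (hb : b ^ 2 = D - t ^ 2 * Real.cos a ^ 2) {n : Vec} (hn : ‖n‖ = 1) (d : Fin 3 → Vec) :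
    (1 - k) * ‖d 2 - dirDeriv t a b z‖ ^ 2 - (2 * t ^ 2 / k + D) * ‖n - dir t a z‖ ^ 2
      + 2 * (inner ℝ (flux t a b z 0) (d 0) + inner ℝ (flux t a b z 1) (d 1)
        + (inner ℝ (fluxDeriv t a b z) (n - dir t a z)
          + inner ℝ (flux t a b z 2) (d 2 - dirDeriv t a b z)))
      ≤ density t n d - density t (dir t a z) ![0, 0, dirDeriv t a b z] := by
  have hn' : n 0 ^ 2 + n 1 ^ 2 + n 2 ^ 2 = 1 := by
    have h := EuclideanSpace.norm_sq_eq n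
    rw [hn] at h
    simpa [Fin.sum_univ_three] using h.symm
  have h1 := Real.sin_sq_add_cos_sq a
  have h2 := Real.sin_sq_add_cos_sq (t * z)
  simp only [density, curl, flux, fluxDeriv, dir, dirDeriv, EuclideanSpace.norm_sq_eq,
    PiLp.inner_apply, Fin.sum_univ_three, Real.norm_eq_abs, sq_abs, PiLp.toLp_apply,
    PiLp.sub_apply, PiLp.zero_apply, Matrix.cons_val_zero, Matrix.cons_val_one, Matrix.cons_val,
    RCLike.inner_apply, conj_trivial]
  generalize Real.sin a = s at *
  generalize Real.cos a = c at *
  generalize Real.sin (t * z) = S at *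
  generalize Real.cos (t * z) = C at *
  have hm : (c * C) ^ 2 + (c * S) ^ 2 + s ^ 2 = 1 := by linear_combination c ^ 2 * h2 + h1
  -- With `e1` and `e2`, this is the Euler–Lagrange equation: `fluxDeriv` equals `t ∇ × m - λ m`
  -- with `λ = D - 2t² c²`.
  have e0 : -((c * b ^ 2 + s * (t ^ 2 * c * s)) * C) + t * (s * b * S)
      = -(t * (-(s * b * S) + t * c * C)) - (D - 2 * t ^ 2 * c ^ 2) * (c * C) := by
    linear_combination (-(c * C)) * hb - t ^ 2 * c * C * h1
  have e1 : -((c * b ^ 2 + s * (t ^ 2 * c * s)) * S) - t * (s * b * C)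
      = t * (-(s * b * C) - t * c * S) - (D - 2 * t ^ 2 * c ^ 2) * (c * S) := by
    linear_combination (-(c * S)) * hb - t ^ 2 * c * S * h1
  have e2 : -(s * b ^ 2) + c * (t ^ 2 * c * s) = -((D - 2 * t ^ 2 * c ^ 2) * s) := by
    linear_combination (-s) * hb
  rw [e0, e1, e2]
  -- `r = t/k` completes the squares in Young's inequality for `2t v · ∇ × v`.
  obtain ⟨r, hr⟩ : ∃ r, t = k * r := ⟨t / k, by field_simp⟩
  have hr2 : 2 * t ^ 2 / k = 2 * t * r := by rw [hr]; field_simp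
  rw [hr2]
  generalize c * b = B2
  obtain ⟨w0, hw0⟩ : ∃ w0, w0 = d 2 0 - (-(s * b * C) - t * c * S) := ⟨_, rfl⟩
  obtain ⟨w1, hw1⟩ : ∃ w1, w1 = d 2 1 - (-(s * b * S) + t * c * C) := ⟨_, rfl⟩
  -- The remainder left out of the lower bound: the squares weighted by `k`, the spare lateral
  -- derivatives, and `(D - λ)|v|²`.
  have h0 : 0 ≤ k * ((d 1 2 + r * (n 0 - c * C)) ^ 2 + (w1 - r * (n 0 - c * C)) ^ 2
      + (w0 + r * (n 1 - c * S)) ^ 2 + (d 0 2 - r * (n 1 - c * S)) ^ 2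
      + (d 0 1 + r * (n 2 - s)) ^ 2 + (d 1 0 - r * (n 2 - s)) ^ 2
      + d 0 0 ^ 2 + d 1 1 ^ 2 + (d 2 2 - B2) ^ 2)
      + (1 - k) * (d 0 0 ^ 2 + d 0 1 ^ 2 + d 0 2 ^ 2 + d 1 0 ^ 2 + d 1 1 ^ 2 + d 1 2 ^ 2)
      + 2 * t ^ 2 * c ^ 2 * ((n 0 - c * C) ^ 2 + (n 1 - c * S) ^ 2 + (n 2 - s) ^ 2) := by
    have := sub_nonneg.2 hk1
    positivity
  refine sub_nonneg.1 (h0.trans_eq ?_)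
  rw [hw0, hw1]
  subst hr
  -- The unit length of both fields enters here, turning `2λ m · v` into `-λ|v|²`.
  linear_combination (D - 2 * (k * r) ^ 2 * c ^ 2) * (hm - hn')

theorem integrable_density {t : ℝ} {μ : Measure Pt} [IsFiniteMeasure μ] {n : Pt → Vec}
    {d : Fin 3 → Pt → Vec} (hn : MemLp n 2 μ) (hd : ∀ j, MemLp (d j) 2 μ) :
    Integrable (fun p => density t (n p) fun j => d j p) μ := by
  have hc : ∀ {u : Pt → Vec}, MemLp u 2 μ → ∀ i, MemLp (fun p => u p i) 2 μ := fun hu i =>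
    hu.continuousLinearMap_comp (EuclideanSpace.proj (𝕜 := ℝ) i)
  have hm : ∀ i j k, Integrable (fun p => n p i * d j p k) μ := fun i j k =>
    (hc hn i).integrable_mul (hc (hd j) k)
  refine ((integrable_finsetSum _ fun j _ => (hd j).integrable_norm_pow (by norm_num)).add
    (Integrable.const_mul ?_ (2 * t))).add (integrable_const _)
  refine (((((hm 0 1 2).sub (hm 0 2 1)).add (hm 1 2 0)).sub (hm 1 0 2)).add
    ((hm 2 0 1).sub (hm 2 1 0))).congr (Eventually.of_forall fun p => ?_)
  simp only [curl, PiLp.inner_apply, Fin.sum_univ_three, Matrix.cons_val_zero,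
    Matrix.cons_val_one, Matrix.cons_val, RCLike.inner_apply, conj_trivial, Pi.add_apply,
    Pi.sub_apply]
  ring

theorem hasDerivAt_dir {t a' z : ℝ} {Θ : ℝ → ℝ} (h : HasDerivAt Θ a' z) :
    HasDerivAt (fun z => dir t (Θ z) z) (dirDeriv t (Θ z) a' z) z := by
  have h1 : HasDerivAt (fun z : ℝ => t * z) t z := by
    simpa only [id_eq, mul_one] using (hasDerivAt_id z).const_mul t
  refine (hasDerivAt_vec (h.cos.mul h1.cos) (h.cos.mul h1.sin) h.sin).congr_deriv ?_
  simp only [dirDeriv]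
  congr 2
  · ring
  · congr 1
    ring

theorem hasDerivAt_flux_two {t z : ℝ} {Θ P : ℝ → ℝ} (h : HasDerivAt Θ (P z) z)
    (hP : HasDerivAt P (t ^ 2 * Real.cos (Θ z) * Real.sin (Θ z)) z) :
    HasDerivAt (fun z => flux t (Θ z) (P z) z 2) (fluxDeriv t (Θ z) (P z) z) z := by
  have h1 : HasDerivAt (fun z : ℝ => t * z) t z := by
    simpa only [id_eq, mul_one] using (hasDerivAt_id z).const_mul t
  refine (hasDerivAt_vec ((h.sin.mul hP).mul h1.cos).neg ((h.sin.mul hP).mul h1.sin).neg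
    (h.cos.mul hP)).congr_deriv ?_
  simp only [fluxDeriv, Pi.mul_apply]
  congr 2
  · ring
  · congr 1
    · ring
    · congr 1
      ring

theorem contDiff_dir {t : ℝ} {Θ : ℝ → ℝ} (h : ContDiff ℝ ∞ Θ) :
    ContDiff ℝ ∞ fun p : Pt => dir t (Θ (p 2)) (p 2) := by
  have h1 : ContDiff ℝ ∞ fun p : Pt => p 2 := by fun_prop
  have h2 := h.comp h1
  have h3 : ContDiff ℝ ∞ fun p : Pt => t * p 2 := by fun_prop
  exact contDiff_vec (h2.cos.mul h3.cos) (h2.cos.mul h3.sin) h2.sin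

theorem contDiff_flux {t : ℝ} {Θ P : ℝ → ℝ} (h : ContDiff ℝ ∞ Θ) (hP : ContDiff ℝ ∞ P)
    (j : Fin 3) : ContDiff ℝ ∞ fun p : Pt => flux t (Θ (p 2)) (P (p 2)) (p 2) j := by
  have h1 : ContDiff ℝ ∞ fun p : Pt => p 2 := by fun_prop
  have h2 := (h.comp h1).cos
  have h2' := (h.comp h1).sin
  have h4 := hP.comp h1
  have h3 : ContDiff ℝ ∞ fun p : Pt => Real.cos (t * p 2) := by fun_prop
  have h3' : ContDiff ℝ ∞ fun p : Pt => Real.sin (t * p 2) := by fun_prop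
  fin_cases j
  · exact contDiff_vec contDiff_const (contDiff_const.mul h2') (contDiff_const.mul (h2.mul h3')).neg
  · exact contDiff_vec (contDiff_const.mul h2').neg contDiff_const (contDiff_const.mul (h2.mul h3))
  · exact contDiff_vec ((h2'.mul h4).mul h3).neg ((h2'.mul h4).mul h3').neg (h2.mul h4)

theorem pderiv_flux_of_ne {t : ℝ} {Θ P : ℝ → ℝ} (h : ContDiff ℝ ∞ Θ) (hP : ContDiff ℝ ∞ P)
    {i j : Fin 3} (hj : j ≠ 2) (p : Pt) :
    pderiv j (fun p : Pt => flux t (Θ (p 2)) (P (p 2)) (p 2) i) p = 0 := by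
  have hc : ContDiff ℝ ∞ fun z : ℝ => (fun _ => z : Pt) := contDiff_pi.2 fun _ => contDiff_id
  have h1 := (contDiff_flux (t := t) h hP i).comp hc
  have h2 := (h1.differentiable (by simp) (p 2)).hasDerivAt
  exact pderiv_comp_coord_of_ne (q := fun z => flux t (Θ z) (P z) z i) h2 hj

/-! ### Admissibility of the profile and comparison of energies -/

theorem lo_le_hi {L₁ L₂ : ℝ} (h₁ : 0 < L₁) (h₂ : 0 < L₂) : lo L₁ L₂ ≤ hi L₁ L₂ := by
  intro i
  fin_cases i <;> simp [lo, hi] <;> linarith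

theorem mem_Icc_of_mem_cuboid {L₁ L₂ : ℝ} {p : Pt} (hp : p ∈ cuboid L₁ L₂) :
    p 2 ∈ Set.Icc (0 : ℝ) 1 := by
  have := hp 2 trivial
  simp only [lo, hi, Matrix.cons_val] at this
  exact ⟨this.1.le, this.2.le⟩

theorem eqOn_cuboid_of_eqOn {t : ℝ} {θ Θ : ℝ → ℝ} (h : Set.EqOn θ Θ (Set.Icc 0 1)) (L₁ L₂ : ℝ) :
    Set.EqOn (profileDirector t θ) (fun p => dir t (Θ (p 2)) (p 2)) (cuboid L₁ L₂) := by
  intro p hp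
  simp only [profileDirector, dir, h (mem_Icc_of_mem_cuboid hp)]

/-- Hence functions of `z` alone have equal traces on opposite lateral faces. -/
theorem insertNth_two (i : Fin 3) (hi : i ≠ 2) (x x' : ℝ) (y : Fin 2 → ℝ) :
    i.insertNth (α := fun _ => ℝ) x y 2 = i.insertNth (α := fun _ => ℝ) x' y 2 := by
  obtain ⟨k, hk⟩ := Fin.exists_succAbove_eq hi.symm
  rw [← hk, Fin.insertNth_apply_succAbove, Fin.insertNth_apply_succAbove]

theorem dir_two_face {t : ℝ} {Θ : ℝ → ℝ} (h0 : Θ 0 = 0) (h1 : Θ 1 = Real.pi / 2) (L₁ L₂ : ℝ)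
    (s : Bool) (y : Fin 2 → ℝ) :
    (fun p : Pt => dir t (Θ (p 2)) (p 2))
      ((2 : Fin 3).insertNth (faceCoord (lo L₁ L₂) (hi L₁ L₂) 2 s) y)
      = if s then !₂[0, 0, 1] else !₂[1, 0, 0] := by
  have : (2 : Fin 3).insertNth (α := fun _ => ℝ) (faceCoord (lo L₁ L₂) (hi L₁ L₂) 2 s) y 2
      = if s then 1 else 0 := by
    rw [Fin.insertNth_apply_same]
    cases s <;> simp [faceCoord, lo, hi]
  simp only [this]
  cases s <;> simp [dir, h0, h1]

theorem admissible_profileDirector {t : ℝ} {θ Θ : ℝ → ℝ} (hΘ : ContDiff ℝ ∞ Θ) (h0 : Θ 0 = 0)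
    (h1 : Θ 1 = Real.pi / 2) (h : Set.EqOn θ Θ (Set.Icc 0 1)) {L₁ L₂ : ℝ} (h₁ : 0 < L₁)
    (h₂ : 0 < L₂) : Admissible L₁ L₂ (profileDirector t θ) := by
  have hU : IsOpen (cuboid L₁ L₂) := isOpen_box _ _
  have hab := lo_le_hi h₁ h₂
  have heq := eqOn_cuboid_of_eqOn (t := t) h L₁ L₂
  have hs := contDiff_dir (t := t) hΘ
  have hs1 : ContDiff ℝ 1 fun p : Pt => dir t (Θ (p 2)) (p 2) := hs.of_le (by simp)
  have hsn : SmoothNear (lo L₁ L₂) (hi L₁ L₂) fun p : Pt => dir t (Θ (p 2)) (p 2) :=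
    fun p _ => hs1.contDiffAt
  have hae : profileDirector t θ =ᵐ[volume.restrict (cuboid L₁ L₂)]
      fun p => dir t (Θ (p 2)) (p 2) := by
    filter_upwards [ae_restrict_mem hU.measurableSet] with p hp using heq hp
  have hw := weakPartial_ae_eq_pderiv hU hs1 heq
  refine ⟨⟨hsn.memLp.ae_eq hae.symm, fun j => ⟨⟨_, isWeakPartial_pderiv hU hs1 heq j⟩,
    (hsn.memLp_pderiv j).ae_eq (hw j).symm⟩⟩, ?_, ?_⟩
  · filter_upwards [hae] with p hp
    rw [hp, norm_dir]
  · refine ⟨fun i s y => (fun p : Pt => dir t (Θ (p 2)) (p 2))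
      (i.insertNth (faceCoord (lo L₁ L₂) (hi L₁ L₂) i s) y), ⟨hsn.memLp_face hab,
      fun _ p => dir t (Θ (p 2)) (p 2), fun _ => hs, ?_, fun j => ?_, fun i s => ?_⟩,
      Eventually.of_forall fun y => ?_, Eventually.of_forall fun y => ?_,
      Eventually.of_forall fun y => ?_, Eventually.of_forall fun y => ?_⟩
    · refine tendsto_const_nhds.congr fun _ => ?_
      rw [eq_comm, eLpNorm_congr_ae (g := 0), eLpNorm_zero]
      filter_upwards [hae] with p hp
      simp [hp]
    · refine tendsto_const_nhds.congr fun _ => ?_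
      rw [eq_comm, eLpNorm_congr_ae (g := 0), eLpNorm_zero]
      filter_upwards [hw j] with p hp
      simp only [Pi.sub_apply, Pi.zero_apply]
      exact sub_eq_zero.2 hp.symm
    · simp
    · exact dir_two_face h0 h1 L₁ L₂ false y
    · exact dir_two_face h0 h1 L₁ L₂ true y
    · dsimp only
      rw [insertNth_two 0 (by decide)]
    · dsimp only
      rw [insertNth_two 1 (by decide)]

theorem Admissible.hasGradTrace {L₁ L₂ : ℝ} {n : Pt → Vec} (h : Admissible L₁ L₂ n) :
    ∃ T : Fin 3 → Bool → (Fin 2 → ℝ) → Vec, HasGradTrace (lo L₁ L₂) (hi L₁ L₂) n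
      (fun j => weakPartial (cuboid L₁ L₂) j n) T ∧
      (T 2 false =ᵐ[faceMeasure (lo L₁ L₂) (hi L₁ L₂) 2] fun _ => !₂[1, 0, 0]) ∧
      (T 2 true =ᵐ[faceMeasure (lo L₁ L₂) (hi L₁ L₂) 2] fun _ => !₂[0, 0, 1]) ∧
      (T 0 false =ᵐ[faceMeasure (lo L₁ L₂) (hi L₁ L₂) 0] T 0 true) ∧
      (T 1 false =ᵐ[faceMeasure (lo L₁ L₂) (hi L₁ L₂) 1] T 1 true) := by
  obtain ⟨hW, -, T, ⟨hT, w, hw, hwu, hwg, hwT⟩, hbc⟩ := h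
  exact ⟨T, ⟨hW.1, fun j => (hW.2 j).2, hT, w, fun k p _ => ((hw k).of_le (by simp)).contDiffAt,
    hwu, hwg, hwT⟩, hbc⟩

theorem energy_eq_integral_density (L₁ L₂ t : ℝ) (n : Pt → Vec) :
    energy L₁ L₂ t n = ∫ p in box (lo L₁ L₂) (hi L₁ L₂),
      density t (n p) fun j => weakPartial (cuboid L₁ L₂) j n p := rfl

/-- `R₀`, `R₁`, `R₂` stand for the parts of the first variation along the three axes, each of
integral zero. -/
theorem integral_ge_of_ae_ge {α : Type*} [MeasurableSpace α] {μ : Measure α}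
    {G V R₀ R₁ R₂ E : α → ℝ} {c K : ℝ} (hG : Integrable G μ) (hV : Integrable V μ)
    (h₀ : Integrable R₀ μ) (h₁ : Integrable R₁ μ) (h₂ : Integrable R₂ μ) (hE : Integrable E μ)
    (e₀ : ∫ x, R₀ x ∂μ = 0) (e₁ : ∫ x, R₁ x ∂μ = 0) (e₂ : ∫ x, R₂ x ∂μ = 0)
    (h : ∀ᵐ x ∂μ, c * G x - K * V x + 2 * (R₀ x + R₁ x + R₂ x) ≤ E x) :
    c * (∫ x, G x ∂μ) - K * ∫ x, V x ∂μ ≤ ∫ x, E x ∂μ := by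
  have hGV : Integrable (fun x => c * G x - K * V x) μ := (hG.const_mul c).sub (hV.const_mul K)
  have hR₀₁ : Integrable (fun x => R₀ x + R₁ x) μ := h₀.add h₁
  have hR : Integrable (fun x => R₀ x + R₁ x + R₂ x) μ := hR₀₁.add h₂
  have := integral_mono_ae (hGV.add (hR.const_mul 2)) hE h
  have e : ∫ x, (c * G x - K * V x + 2 * (R₀ x + R₁ x + R₂ x)) ∂μ
      = c * (∫ x, G x ∂μ) - K * ∫ x, V x ∂μ := by
    rw [integral_add hGV (hR.const_mul 2), integral_sub (hG.const_mul c) (hV.const_mul K),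
      integral_const_mul, integral_const_mul, integral_const_mul, integral_add hR₀₁ h₂,
      integral_add h₀ h₁, e₀, e₁, e₂]
    ring
  exact e.symm.trans_le this

/-- The excess of the energy over the energy of the profile controls the distance in `L²`. -/
theorem energy_sub_energy_ge {t D k r : ℝ} (hD : t ^ 2 < D) (hk : 0 < k) (hk1 : k ≤ 1)
    (hr : 0 < r) (hrπ : r < Real.pi) {θ Θ : ℝ → ℝ} (hΘ : ContDiff ℝ ∞ Θ) (h0 : Θ 0 = 0)
    (h1 : Θ 1 = Real.pi / 2)
    (hΘd : ∀ z, HasDerivAt Θ (√(D - t ^ 2 * Real.cos (Θ z) ^ 2)) z)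
    (h : Set.EqOn θ Θ (Set.Icc 0 1)) {L₁ L₂ : ℝ} (h₁ : 0 < L₁) (h₂ : 0 < L₂) {n : Pt → Vec}
    (hn : Admissible L₁ L₂ n) :
    ((1 - k) * r ^ 2 - (2 * t ^ 2 / k + D))
      * ∫ p in cuboid L₁ L₂, ‖n p - profileDirector t θ p‖ ^ 2
      ≤ energy L₁ L₂ t n - energy L₁ L₂ t (profileDirector t θ) := by
  set P : ℝ → ℝ := fun z => √(D - t ^ 2 * Real.cos (Θ z) ^ 2) with hP
  have hPd : ∀ z, HasDerivAt P (t ^ 2 * Real.cos (Θ z) * Real.sin (Θ z)) z := fun z =>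
    hasDerivAt_profile_deriv hD (hΘd z)
  have hPs : ContDiff ℝ ∞ P := (contDiff_const.sub (contDiff_const.mul (hΘ.cos.pow 2))).sqrt
    fun z => (profile_radicand_pos hD (Θ z)).ne'
  have hPsq : ∀ z, P z ^ 2 = D - t ^ 2 * Real.cos (Θ z) ^ 2 := fun z =>
    Real.sq_sqrt (profile_radicand_pos hD (Θ z)).le
  have hab := lo_le_hi h₁ h₂
  have hU : IsOpen (cuboid L₁ L₂) := isOpen_box _ _
  have heq := eqOn_cuboid_of_eqOn (t := t) h L₁ L₂
  set m : Pt → Vec := fun p => dir t (Θ (p 2)) (p 2) with hm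
  have hms : ContDiff ℝ 1 m := (contDiff_dir hΘ).of_le (by simp)
  have hmn : SmoothNear (lo L₁ L₂) (hi L₁ L₂) m := fun p _ => hms.contDiffAt
  have hmd : ∀ p : Pt, ∀ j, pderiv j m p
      = (![0, 0, dirDeriv t (Θ (p 2)) (P (p 2)) (p 2)] : Fin 3 → Vec) j := by
    intro p j
    have hd := hasDerivAt_dir (t := t) (hΘd (p 2))
    fin_cases j
    · exact pderiv_comp_coord_of_ne hd (by decide)
    · exact pderiv_comp_coord_of_ne hd (by decide)
    · exact pderiv_two_comp_coord hd
  set A : Fin 3 → Pt → Vec := fun j p => flux t (Θ (p 2)) (P (p 2)) (p 2) j with hA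
  have hAs : ∀ j, SmoothNear (lo L₁ L₂) (hi L₁ L₂) (A j) := fun j p _ =>
    ((contDiff_flux hΘ hPs j).of_le (by simp)).contDiffAt
  have hA2 : ∀ p, pderiv 2 (A 2) p = fluxDeriv t (Θ (p 2)) (P (p 2)) (p 2) := fun p =>
    pderiv_two_comp_coord (hasDerivAt_flux_two (hΘd (p 2)) (hPd (p 2)))
  obtain ⟨T, hnT, hT20, hT21, hT0, hT1⟩ := hn.hasGradTrace
  have hv := hnT.sub hab (hmn.hasGradTrace hab)
  have hS2 : ∀ s, (fun y => T 2 s y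
      - m ((2 : Fin 3).insertNth (faceCoord (lo L₁ L₂) (hi L₁ L₂) 2 s) y))
      =ᵐ[faceMeasure (lo L₁ L₂) (hi L₁ L₂) 2] 0 := by
    rintro (_ | _)
    · filter_upwards [hT20] with y hy
      rw [hy, hm, dir_two_face h0 h1]
      simp
    · filter_upwards [hT21] with y hy
      rw [hy, hm, dir_two_face h0 h1]
      simp
  have hpoinc := hv.poincare hab (by simp [lo]) (by simp [hi]) hS2 hr hrπ
  have g2 := ((hAs 2).hasGradTrace hab).integral_inner_add hab hv 2
  have hz : ∀ s, ∫ y, inner ℝ (A 2 ((2 : Fin 3).insertNth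
      (faceCoord (lo L₁ L₂) (hi L₁ L₂) 2 s) y)) (T 2 s y
      - m ((2 : Fin 3).insertNth (faceCoord (lo L₁ L₂) (hi L₁ L₂) 2 s) y))
      ∂faceMeasure (lo L₁ L₂) (hi L₁ L₂) 2 = 0 := by
    intro s
    refine integral_eq_zero_of_ae ?_
    filter_upwards [hS2 s] with y hy
    simp only [Pi.zero_apply] at hy ⊢
    rw [hy, inner_zero_right]
  -- The flux is constant along lateral axes, so only a difference of boundary integrals survives,
  -- and periodicity makes it zero.
  have glat : ∀ j : Fin 3, j ≠ 2 → T j false =ᵐ[faceMeasure (lo L₁ L₂) (hi L₁ L₂) j] T j true →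
      (∀ p, pderiv j (A j) p = 0) →
      ∫ p in box (lo L₁ L₂) (hi L₁ L₂),
        inner ℝ (A j p) (weakPartial (cuboid L₁ L₂) j n p) = 0 := by
    intro j hj hTj hAj
    have g := ((hAs j).hasGradTrace hab).integral_inner_add hab hv j
    have hmj : ∀ p, pderiv j m p = 0 := fun p => pderiv_comp_coord_of_ne (hasDerivAt_dir (hΘd _)) hj
    simp only [hAj, inner_zero_left, zero_add, Pi.sub_apply, hmj, sub_zero] at g
    rw [g, sub_eq_zero]
    refine integral_congr_ae ?_
    filter_upwards [hTj] with y hy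
    simp only [hA, hm, hy]
    rw [insertNth_two j hj (faceCoord (lo L₁ L₂) (hi L₁ L₂) j true)
      (faceCoord (lo L₁ L₂) (hi L₁ L₂) j false)]
  have hAz : ∀ j : Fin 3, j ≠ 2 → ∀ p, pderiv j (A j) p = 0 := fun j hj p =>
    pderiv_flux_of_ne hΘ hPs hj p
  replace glat : ∀ j : Fin 3, j ≠ 2 → T j false =ᵐ[faceMeasure (lo L₁ L₂) (hi L₁ L₂) j] T j true →
      ∫ p in box (lo L₁ L₂) (hi L₁ L₂),
        inner ℝ (A j p) (weakPartial (cuboid L₁ L₂) j n p) = 0 :=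
    fun j hj hTj => glat j hj hTj (hAz j hj)
  simp only [Pi.sub_apply] at g2 hpoinc
  rw [hz, hz, sub_zero] at g2
  have i0 := fun j => integrable_inner_of_memLp (hAs j).memLp (hnT.memLp_grad j)
  have i2 := (integrable_inner_of_memLp ((hAs 2).memLp_pderiv 2) hv.memLp).add
    (integrable_inner_of_memLp (hAs 2).memLp (hv.memLp_grad 2))
  have iv := hv.memLp.integrable_norm_pow (by norm_num)
  have ig := (hv.memLp_grad 2).integrable_norm_pow (by norm_num)
  have hwm := weakPartial_ae_eq_pderiv hU hms heq
  have hen : energy L₁ L₂ t (profileDirector t θ)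
      = ∫ p in box (lo L₁ L₂) (hi L₁ L₂), density t (m p) fun j => pderiv j m p := by
    rw [energy_eq_integral_density]
    refine integral_congr_ae ?_
    filter_upwards [ae_restrict_mem hU.measurableSet, hwm 0, hwm 1, hwm 2] with p hp p0 p1 p2
    have : (fun j => weakPartial (cuboid L₁ L₂) j (profileDirector t θ) p)
        = fun j => pderiv j m p := by
      funext j
      fin_cases j
      · exact p0
      · exact p1
      · exact p2
    rw [heq hp, this]
  have hvv : ∫ p in cuboid L₁ L₂, ‖n p - profileDirector t θ p‖ ^ 2
      = ∫ p in box (lo L₁ L₂) (hi L₁ L₂), ‖(n - m) p‖ ^ 2 := by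
    refine setIntegral_congr_fun hU.measurableSet fun p hp => ?_
    simp only [heq hp, Pi.sub_apply, hm]
  have hin := integrable_density (t := t) hnT.memLp hnT.memLp_grad
  have him := integrable_density (t := t) hmn.memLp hmn.memLp_pderiv
  have hpt : ∀ᵐ p ∂volume.restrict (box (lo L₁ L₂) (hi L₁ L₂)),
      (1 - k) * ‖weakPartial (cuboid L₁ L₂) 2 n p - pderiv 2 m p‖ ^ 2
        - (2 * t ^ 2 / k + D) * ‖n p - m p‖ ^ 2
        + 2 * (inner ℝ (A 0 p) (weakPartial (cuboid L₁ L₂) 0 n p)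
          + inner ℝ (A 1 p) (weakPartial (cuboid L₁ L₂) 1 n p)
          + (inner ℝ (pderiv 2 (A 2) p) (n p - m p)
            + inner ℝ (A 2 p) (weakPartial (cuboid L₁ L₂) 2 n p - pderiv 2 m p)))
      ≤ (density t (n p) fun j => weakPartial (cuboid L₁ L₂) j n p)
          - density t (m p) fun j => pderiv j m p := by
    filter_upwards [hn.2.1] with p hp
    have hd : (fun j => pderiv j m p)
        = (![0, 0, dirDeriv t (Θ (p 2)) (P (p 2)) (p 2)] : Fin 3 → Vec) := funext (hmd p)
    have hd2 : pderiv 2 m p = dirDeriv t (Θ (p 2)) (P (p 2)) (p 2) := hmd p 2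
    rw [hd, hd2, hA2]
    have hden := density_sub_density_ge (t := t) (z := p 2) hk hk1 (hPsq (p 2)) hp
      fun j => weakPartial (cuboid L₁ L₂) j n p
    simp only [hA, hm]
    exact hden
  have hlow := integral_ge_of_ae_ge ig iv (i0 0) (i0 1) i2 (hin.sub him)
    (glat 0 (by decide) hT0) (glat 1 (by decide) hT1) g2 hpt
  have hdiff := integral_sub hin him
  have hlow' := hlow.trans_eq hdiff
  rw [hvv, energy_eq_integral_density, hen]
  -- The factor `1 - k` of `|∂₂v|²` left after Young's inequality is spent on the Poincaré
  -- inequality.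
  have hmul := mul_le_mul_of_nonneg_left hpoinc (sub_nonneg.2 hk1)
  refine le_trans ?_ hlow'
  refine (le_of_eq ?_).trans (sub_le_sub_right hmul _)
  simp only [Pi.sub_apply]
  ring

theorem isUniqueGlobalMinimiser_profileDirector {t D k r : ℝ} (hD : t ^ 2 < D) (hk : 0 < k)
    (hk1 : k ≤ 1) (hr : 0 < r) (hrπ : r < Real.pi)
    (hgap : 2 * t ^ 2 / k + D < (1 - k) * r ^ 2) {θ Θ : ℝ → ℝ} (hΘ : ContDiff ℝ ∞ Θ)
    (h0 : Θ 0 = 0) (h1 : Θ 1 = Real.pi / 2)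
    (hΘd : ∀ z, HasDerivAt Θ (√(D - t ^ 2 * Real.cos (Θ z) ^ 2)) z)
    (h : Set.EqOn θ Θ (Set.Icc 0 1)) {L₁ L₂ : ℝ} (h₁ : 0 < L₁) (h₂ : 0 < L₂) :
    IsUniqueGlobalMinimiser L₁ L₂ t (profileDirector t θ) := by
  have hadm := admissible_profileDirector (t := t) hΘ h0 h1 h h₁ h₂
  have hc := sub_pos.2 hgap
  have hI : ∀ n : Pt → Vec, 0 ≤ ∫ p in cuboid L₁ L₂, ‖n p - profileDirector t θ p‖ ^ 2 :=
    fun n => integral_nonneg fun _ => by positivity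
  refine ⟨hadm, fun n hn => ?_, fun n hn hen => ?_⟩
  · have := energy_sub_energy_ge hD hk hk1 hr hrπ hΘ h0 h1 hΘd h h₁ h₂ hn
    nlinarith [mul_nonneg hc.le (hI n)]
  · have := energy_sub_energy_ge hD hk hk1 hr hrπ hΘ h0 h1 hΘd h h₁ h₂ hn
    rw [hen, sub_self] at this
    have h0 : ∫ p in cuboid L₁ L₂, ‖n p - profileDirector t θ p‖ ^ 2 = 0 :=
      le_antisymm (nonpos_of_mul_nonpos_right this hc) (hI n)
    replace h0 := (integral_eq_zero_iff_of_nonneg (fun _ => by positivity)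
      ((hn.1.1.sub hadm.1.1).integrable_norm_pow (by norm_num))).1 h0
    filter_upwards [h0] with p hp
    simpa [sub_eq_zero] using hp

/-- `k = 0.345` is close to the optimal `√2 t/π` at `t = 0.766`, and `3.14` stands in for `π`. At
the endpoint the two sides are about `6.456` and `6.458`. -/
theorem profile_gap {t D : ℝ} (h0 : 0 ≤ t) (ht : t ≤ 0.766) (hD : D ≤ Real.pi ^ 2 / 4 + t ^ 2) :
    2 * t ^ 2 / 0.345 + D < (1 - 0.345) * (3.14 : ℝ) ^ 2 := by
  have h1 : t ^ 2 ≤ 0.766 ^ 2 := pow_le_pow_left₀ h0 ht 2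
  have h2 : Real.pi ^ 2 ≤ 3.1416 ^ 2 := pow_le_pow_left₀ Real.pi_pos.le Real.pi_lt_d4.le 2
  norm_num at h1 h2 ⊢
  linarith

end Cholesteric

end

theorem theorem2 :
    ∃ tstar : ℝ, 0 < tstar ∧ 0.766 ≤ tstar ∧
      ∀ t : ℝ, 0 ≤ t → t ≤ tstar →
        (∃! D : ℝ, Cholesteric.IsProfileConstant t D) ∧
        ∀ D : ℝ, Cholesteric.IsProfileConstant t D →
          (∃ θ : ℝ → ℝ, Cholesteric.IsProfile t D θ ∧
            ∀ θ' : ℝ → ℝ, Cholesteric.IsProfile t D θ' → Set.EqOn θ' θ (Set.Icc 0 1)) ∧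
          ∀ θ : ℝ → ℝ, Cholesteric.IsProfile t D θ →
            ∀ L₁ L₂ : ℝ, 0 < L₁ → 0 < L₂ →
              Cholesteric.IsUniqueGlobalMinimiser L₁ L₂ t
                (Cholesteric.profileDirector t θ) := by
  refine ⟨0.766, by norm_num, le_rfl, fun t h0 ht => ⟨?_, fun D hD => ?_⟩⟩
  · apply Cholesteric.existsUnique_isProfileConstant
    have h1 : t ^ 2 ≤ 0.766 ^ 2 := pow_le_pow_left₀ h0 ht 2
    norm_num at h1 ⊢
    nlinarith [Real.pi_gt_three]
  · obtain ⟨Θ, hΘ, hG, hu, hΘd⟩ := Cholesteric.exists_smooth_profile hD.1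
    refine ⟨⟨Θ, fun z _ => hG z, fun θ' hθ' z hz => hu _ _ (hθ' z hz)⟩,
      fun θ hθ L₁ L₂ h₁ h₂ => ?_⟩
    exact Cholesteric.isUniqueGlobalMinimiser_profileDirector hD.1 (k := 0.345) (r := 3.14)
      (by norm_num) (by norm_num) (by norm_num) Real.pi_gt_d2 (Cholesteric.profile_gap h0 ht hD.le)
      -- The boundary values `Θ 0 = 0` and `Θ 1 = π/2` follow from uniqueness; the second is exactly
      -- the equation defining `D`.
      hΘ (hu 0 0 (by simp)).symm (hu _ 1 hD.2).symm hΘd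
      (fun z hz => hu _ _ (hθ z hz)) h₁ h₂
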